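/- Let $q$ be an odd prime power, let $m\ge 1$, let $\lambda$ be a positive divisor of $q-1$, put $a_1=\lambda(q+1)$, and let $2\le a_j\le q^2-1$ for $j=2,\dots,m$ be integers. Put $n=a_1a_2\cdots a_m$ and $E=\prod_{j=1}^m\{0,1,\dots,a_j-1\}$. Let $\eta\in\mathbb F_{q^2}$ be a primitive $\lambda(q+1)$-th root of unity and put $\xi_{1,s}=\eta^s$ for $0\le s<a_1$. For $j=2,\dots,m$ let $\xi_{j,0},\dots,\xi_{j,a_j-1}$ be distinct nonzero elements of $\mathbb F_{q^2}$ (an arbitrary set of $a_j$ elements of $\mathbb F_{q^2}^*$ in an arbitrary order). For $\alpha=(\alpha_1,\dots,\alpha_m)\in E$ put $P_\alpha=(\xi_{1,\alpha_1},\dots,\xi_{m,\alpha_m})$. Order $E$ lexicographically, and index the coordinates of vectors of length $n$ over $\mathbb F_{q^2}$ by $E$ in this order. Let $\zeta$ be a primitive element of $\mathbb F_{q^2}$, and let $v=(v_\alpha)_{\alpha\in E}$ be the vector that consists of $q+1$ consecutive blocks of length $\frac{n}{q+1}$, each of them constant, with the values $\zeta^{\frac{q-1}2},\,1,\,\zeta^{\frac{q-1}2},\,1,\,\dots,\,\zeta^{\frac{q-1}2},\,1$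 in turn. For $\Delta\subseteq E$ let $$C_{v,\Delta}=\operatorname{Span}_{\mathbb F_{q^2}}\Big\{\big(v_\alpha\, X^e(P_\alpha)\big)_{\alpha\in E}\ :\ e\in\Delta\Big\}\subseteq\mathbb F_{q^2}^n,\qquad X^e=X_1^{e_1}\cdots X_m^{e_m}.$$ Let $2\le t\le\frac{q+3}2$ be an integer and $$\Delta_t=\Big\{e=(e_1,\dots,e_m)\in E\ :\ \prod_{j=1}^m(e_j+1)<t\Big\}.$$ Then $C_{v,\Delta_t}$ is Hermitian self-orthogonal, that is, $C_{v,\Delta_t}\subseteq (C_{v,\Delta_t})^{\perp_h}$, where $\perp_h$ denotes the dual with respect to $x\cdot_h y=\sum_i x_iy_i^q$. Moreover $2\,\#\Delta_t\le n$, and there exists a stabilizer quantum code with parameters $$[[\,n,\ n-2\,\#\Delta_t,\ \ge t\,]]_q .$$ Here an $[[n,k,\ge d]]_q$ stabilizer code is a $q^k$-dimensional subspace $Q\neq 0$ of $\mathbb C^{q^n}$ that is the joint eigenspace, for the eigenvalue $1$, of an abelian subgroup of the error group $\{\omega^cX(a)Z(b) : c\in\mathbb Z,\ a,b\in\mathbb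 F_q^n\}$, and that detects every error of weight less than $d$. Here $p$ is the characteristic of $\mathbb F_q$, $\omega=e^{2\pi i/p}$, $X(a)|x\rangle=|x+a\rangle$, $Z(b)|x\rangle=\omega^{\operatorname{tr}_{\mathbb F_q/\mathbb F_p}(b\cdot x)}|x\rangle$ for $x\in\mathbb F_q^n$, and the weight of $\omega^cX(a)Z(b)$ is $\#\{i:(a_i,b_i)\ne(0,0)\}$. The code $Q$ detects $T$ if there is $c_T\in\mathbb C$ with $\langle\varphi|T|\psi\rangle=c_T\langle\varphi|\psi\rangle$ for all $\varphi,\psi\in Q$. If $k=0$, it is required, as usual, that $c_T=0$ for every error $T$ of weight at least $1$ and less than $d$. -/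

import Mathlib

/-! Twisted evaluation codes on Cartesian sets and stabilizer quantum codes. -/

namespace GMCC

section Codes

variable {K : Type*} [Field K]

/-- The Hermitian dual `{b | ∀ c ∈ C, ∑ i, b i * (c i) ^ q = 0}` of a linear code `C` over a field
`K` (of order `q ^ 2`) with coordinates indexed by `ι`. -/
def hermitianDual {ι : Type*} [Fintype ι] (q : ℕ) (C : Submodule K (ι → K)) :
    Submodule K (ι → K) where
  carrier := {b | ∀ c ∈ C, ∑ i, b i * c i ^ q = 0}
  add_mem' := by
    intro x y hx hy c hc
    simp only [Pi.add_apply, add_mul, Finset.sum_add_distrib]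
    rw [hx c hc, hy c hc, add_zero]
  zero_mem' := by
    intro c _
    simp
  smul_mem' := by
    intro r x hx c hc
    simp only [Pi.smul_apply, smul_eq_mul, mul_assoc]
    rw [← Finset.mul_sum, hx c hc, mul_zero]

variable {m : ℕ}

/-- The index set `E = {0, …, a₁ - 1} × ⋯ × {0, …, a_m - 1}`. It indexes both the exponents of the
monomials and the coordinates of the codewords. The first index `j = 1` is `0 : Fin m`. -/
abbrev Box (a : Fin m → ℕ) : Type := (j : Fin m) → Fin (a j)

/-- The vector `ev_v (X ^ e)`: its coordinate at `α` is `v α` times the value of the monomial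
`X ^ e` at the point `P_α = (ξ 1 α₁, …, ξ m α_m)`. -/
def evalMonomial {a : Fin m → ℕ} (ξ : (j : Fin m) → Fin (a j) → K) (v : Box a → K)
    (e : Box a) : Box a → K :=
  fun α => v α * ∏ j, ξ j (α j) ^ (e j : ℕ)

/-- The generalized monomial-Cartesian code `C_{v,Δ}`, the span of the `ev_v (X ^ e)`, `e ∈ Δ`. -/
def code {a : Fin m → ℕ} (ξ : (j : Fin m) → Fin (a j) → K) (v : Box a → K)
    (Δ : Finset (Box a)) : Submodule K (Box a → K) :=
  Submodule.span K (evalMonomial ξ v '' (Δ : Set (Box a)))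

/-- The position, counted from `0`, of `α` in the lexicographic enumeration of `E`. -/
noncomputable def lexPosition {a : Fin m → ℕ} (α : Box a) : ℕ :=
  Set.ncard {β : Box a | toLex β < toLex α}

/-- The twist vector. In the lexicographic order of its `n = ∏ j, a j` coordinates it
consists of `q + 1` consecutive blocks of length `n / (q + 1)`, which are constant with the values
`ζ ^ ((q - 1) / 2), 1, ζ ^ ((q - 1) / 2), 1, …` in turn. -/
noncomputable def twistVector (q : ℕ) (ζ : K) (a : Fin m → ℕ) : Box a → K :=
  fun α => if Even (lexPosition α / ((∏ j, a j) / (q + 1))) then ζ ^ ((q - 1) / 2) else 1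

/-- The hyperbolic set `Δ_t = {e ∈ E | ∏ j, (e j + 1) < t}`. -/
def hyperbolicSet (a : Fin m → ℕ) (t : ℕ) : Finset (Box a) :=
  Finset.univ.filter fun e => ∏ j, ((e j : ℕ) + 1) < t

end Codes

section Quantum

variable (F : Type*) [Field F] [Finite F]

/-- The additive character `x ↦ exp (2 π i tr x / p)` of a finite field `F` of characteristic `p`,
where `tr` is the trace from `F` to its prime field. -/
noncomputable def traceChar : AddChar F ℂ :=
  haveI : Fact (ringChar F).Prime := ⟨CharP.char_is_prime F (ringChar F)⟩
  letI : Algebra (ZMod (ringChar F)) F := ZMod.algebra F (ringChar F)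
  (ZMod.stdAddChar (N := ringChar F)).compAddMonoidHom
    (Algebra.trace (ZMod (ringChar F)) F).toAddMonoidHom

variable (n : ℕ)

/-- The state space `(ℂ ^ q) ^ {⊗ n} = ℂ ^ (F ^ n)` of `n` quantum systems with `q = #F` levels:
`φ` stands for `∑ x, φ x |x⟩`. -/
abbrev State : Type _ := (Fin n → F) → ℂ

variable {F n}

/-- The error operator `X(a) Z(b)`, where `X(a) |x⟩ = |x + a⟩` and `Z(b) |x⟩ = χ(b · x) |x⟩`, with
`χ` the trace character. -/
noncomputable def errorOp (a b : Fin n → F) : State F n →ₗ[ℂ] State F n where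
  toFun φ := fun x => traceChar F (b ⬝ᵥ (x - a)) * φ (x - a)
  map_add' := by
    intro φ ψ
    funext x
    simp [mul_add]
  map_smul' := by
    intro r φ
    funext x
    simp [mul_left_comm]

open Classical in
/-- The weight of `X(a) Z(b)`: the number of systems on which it acts nontrivially. -/
noncomputable def errorWeight (a b : Fin n → F) : ℕ :=
  hammingNorm fun i => (a i, b i)

variable (F n) in
/-- The elements `ω ^ c X(a) Z(b)`, with `ω = exp (2 π i / p)`, of the error group. -/
def errorGroup : Set (State F n →ₗ[ℂ] State F n) :=
  {T | ∃ (c : ℕ) (a b : Fin n → F),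
    T = Complex.exp (2 * Real.pi * Complex.I / (ringChar F : ℂ)) ^ c • errorOp a b}

/-- `Q` is a stabilizer code: a nonzero subspace that is the joint eigenspace, for the
eigenvalue `1`, of an abelian subgroup `S` of the error group. -/
def IsStabilizerCode (Q : Submodule ℂ (State F n)) : Prop :=
  Q ≠ ⊥ ∧ ∃ S : Subgroup (LinearMap.GeneralLinearGroup ℂ (State F n)),
    (∀ g ∈ S, (g : State F n →ₗ[ℂ] State F n) ∈ errorGroup F n) ∧
    (∀ g ∈ S, ∀ h ∈ S, g * h = h * g) ∧
    ∀ φ : State F n, φ ∈ Q ↔ ∀ g ∈ S, (g : State F n →ₗ[ℂ] State F n) φ = φ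

variable [Fintype F]

/-- `Q` detects the error `T`: on `Q`, the form `⟨φ, T ψ⟩` is a multiple of `⟨φ, ψ⟩`. -/
def Detects (Q : Submodule ℂ (State F n)) (T : State F n →ₗ[ℂ] State F n) : Prop :=
  ∃ c : ℂ, ∀ φ ∈ Q, ∀ ψ ∈ Q, star φ ⬝ᵥ T ψ = c * (star φ ⬝ᵥ ψ)

/-- `Q` has minimum distance at least `d`: it detects every error of weight less than `d`. A
one-dimensional code detects every operator; for it, as usual, the nontrivial errors
of weight less than `d` are required to map `Q` into its orthogonal complement. -/
def MinDistAtLeast (Q : Submodule ℂ (State F n)) (d : ℕ) : Prop :=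
  (∀ a b : Fin n → F, errorWeight a b < d → Detects Q (errorOp a b)) ∧
  (Module.finrank ℂ Q = 1 → ∀ a b : Fin n → F, 0 < errorWeight a b → errorWeight a b < d →
    ∀ φ ∈ Q, ∀ ψ ∈ Q, star φ ⬝ᵥ errorOp a b ψ = 0)

variable (F) in
/-- There is a stabilizer code with parameters `[[n, k, ≥ d]]_q`, where `q = #F`. -/
def ExistsStabilizerCode (n k d : ℕ) : Prop :=
  ∃ Q : Submodule ℂ (State F n),
    IsStabilizerCode Q ∧ Module.finrank ℂ Q = Fintype.card F ^ k ∧ MinDistAtLeast Q d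

end Quantum

end GMCC

/-! ### Error operators and stabilizer codes of isotropic subspaces. -/

namespace GMCC

/-! Self-orthogonality. The Hermitian product of two generators `X ^ e`, `X ^ e'` factors over the
coordinates, since the weight `v_α ^ (q + 1)` depends on `α₁` only: it is `-1` and `1` alternately
on runs of length `l`. The first factor is `S = ∑ u s * x ^ s` with `x = η ^ (e₁ + q e₁')`; shifting
`s` by `l` negates `u`, so `(x ^ l + 1) S = 0`. Now `θ = η ^ l` has order `q + 1`, so `x ^ l = θ ^
(e₁ - e₁')`, and `t ≤ (q + 3) / 2` forces `|e₁ - e₁'| < (q + 1) / 2`. Hence `x ^ l ≠ -1` and `S = 0`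
(`sum_evalMonomial_mul_pow_eq_zero`).

Distance. By the footprint bound, functions on a finite set `T` of points are spanned by monomials
with `∏ (e_j + 1) ≤ #T` (`span_monomialFun_eq_top`). If `#T < t`, all of these lie in `Δ_t`, so the
code restricts onto `K ^ T` and no nonzero dual word is supported on `T`
(`eq_zero_of_mem_hermitianDual`).

Quantum code. Writing `K = F ⊕ δ F` with `δ ^ q = -δ` turns the code into an isotropic subspace `A`
of `F ^ n × F ^ n`. For odd `q`, suitable phases make its error operators a representation of `A`;
the stabilizer code is the space of invariants (`existsStabilizerCode_of_le_hermitianDual`). -/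

theorem exists_symplectic_ne_zero {F : Type*} [Field F] {n : ℕ} {a b : Fin n → F} (h : a ≠ 0 ∨ b ≠ 0) :
    ∃ a' b' : Fin n → F, b ⬝ᵥ a' - b' ⬝ᵥ a ≠ 0 := by
  rcases h with h | h
  · obtain ⟨i, hi⟩ := Function.ne_iff.mp h
    exact ⟨0, Pi.single i 1, by simpa using hi⟩
  · obtain ⟨i, hi⟩ := Function.ne_iff.mp h
    exact ⟨Pi.single i 1, 0, by simpa using hi⟩

theorem errorWeight_eq_zero {F : Type*} [Field F] {n : ℕ} {a b : Fin n → F} :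
    errorWeight a b = 0 ↔ a = 0 ∧ b = 0 := by
  classical
  rw [errorWeight, hammingNorm_eq_zero]
  exact ⟨fun h => ⟨funext fun i => congrArg Prod.fst (congrFun h i),
    funext fun i => congrArg Prod.snd (congrFun h i)⟩, by rintro ⟨rfl, rfl⟩; rfl⟩

section TraceCharacter

variable {F : Type*} [Field F] [Finite F]

theorem exists_traceChar_mul_ne_one {s : F} (hs : s ≠ 0) : ∃ r : F, traceChar F (r * s) ≠ 1 := by
  have : Fact (ringChar F).Prime := ⟨CharP.char_is_prime F (ringChar F)⟩
  let : Algebra (ZMod (ringChar F)) F := ZMod.algebra F (ringChar F)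
  obtain ⟨b, hb⟩ := FiniteField.trace_to_zmod_nondegenerate F hs
  refine ⟨b, fun h => hb ?_⟩
  rw [mul_comm] at h
  change ZMod.stdAddChar (N := ringChar F) (Algebra.trace (ZMod (ringChar F)) F (s * b)) = 1 at h
  rw [← AddChar.map_zero_eq_one (ZMod.stdAddChar (N := ringChar F))] at h
  exact ZMod.injective_stdAddChar h

theorem exists_traceChar_eq_pow (x : F) :
    ∃ c : ℕ, traceChar F x = Complex.exp (2 * Real.pi * Complex.I / (ringChar F : ℂ)) ^ c := by
  have : Fact (ringChar F).Prime := ⟨CharP.char_is_prime F (ringChar F)⟩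
  let : Algebra (ZMod (ringChar F)) F := ZMod.algebra F (ringChar F)
  set y := Algebra.trace (ZMod (ringChar F)) F x with hy
  refine ⟨y.val, ?_⟩
  change ZMod.stdAddChar (N := ringChar F) y = _
  have h : y = ((y.val : ℤ) : ZMod (ringChar F)) := by simp
  conv_lhs => rw [h]
  rw [ZMod.stdAddChar_coe, ← Complex.exp_nat_mul]
  congr 1
  push_cast
  ring

theorem star_traceChar (x : F) : star (traceChar F x) * traceChar F x = 1 := by
  have h : ‖traceChar F x‖ = 1 := AddChar.norm_apply _ _
  rw [Complex.star_def, Complex.conj_mul', h]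
  simp

end TraceCharacter

section ErrorOperators

variable {F : Type*} [Field F] [Finite F] {n : ℕ}

theorem errorOp_apply (a b : Fin n → F) (φ : State F n) (x : Fin n → F) :
    errorOp a b φ x = traceChar F (b ⬝ᵥ (x - a)) * φ (x - a) := rfl

theorem errorOp_mul (a b a' b' : Fin n → F) :
    errorOp a b * errorOp a' b' = traceChar F (b ⬝ᵥ a') • errorOp (a + a') (b + b') := by
  refine LinearMap.ext fun φ => funext fun x => ?_
  simp only [Module.End.mul_apply, LinearMap.smul_apply, Pi.smul_apply, smul_eq_mul,
    errorOp_apply, ← mul_assoc, ← AddChar.map_add_eq_mul]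
  rw [sub_sub]
  congr 2
  simp only [dotProduct_sub, dotProduct_add, add_dotProduct]
  ring

theorem errorOp_zero : errorOp (0 : Fin n → F) 0 = 1 := by
  refine LinearMap.ext fun φ => funext fun x => ?_
  simp [errorOp_apply]

theorem errorOp_commute (a b a' b' : Fin n → F) :
    errorOp a b * errorOp a' b' =
      traceChar F (b ⬝ᵥ a' - b' ⬝ᵥ a) • (errorOp a' b' * errorOp a b) := by
  rw [errorOp_mul, errorOp_mul, smul_smul, ← AddChar.map_add_eq_mul, sub_add_cancel, add_comm a,
    add_comm b]

theorem errorOp_star_dotProduct [Fintype F] (a b : Fin n → F) (φ ψ : State F n) :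
    star (errorOp a b φ) ⬝ᵥ errorOp a b ψ = star φ ⬝ᵥ ψ := by
  change ∑ x, star (errorOp a b φ x) * errorOp a b ψ x = ∑ x, star (φ x) * ψ x
  simp only [errorOp_apply]
  rw [← Equiv.sum_comp (Equiv.subRight a) (fun x => star (φ x) * ψ x)]
  refine Finset.sum_congr rfl fun x _ => ?_
  rw [star_mul, Equiv.subRight_apply]
  linear_combination (star (φ (x - a)) * ψ (x - a)) * star_traceChar (F := F) (b ⬝ᵥ (x - a))

theorem exists_traceChar_symplectic_ne_one {a b a' b' : Fin n → F}
    (h : b ⬝ᵥ a' - b' ⬝ᵥ a ≠ 0) :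
    ∃ r : F, traceChar F (b ⬝ᵥ (r • a') - (r • b') ⬝ᵥ a) ≠ 1 := by
  obtain ⟨r, hr⟩ := exists_traceChar_mul_ne_one h
  refine ⟨r, ?_⟩
  rwa [dotProduct_smul, smul_dotProduct, ← smul_sub, smul_eq_mul]

/-- Conjugating by a suitable error operator multiplies this one by a scalar other than `1`, whereas
the trace is invariant under conjugation. -/
theorem trace_errorOp_eq_zero {a b : Fin n → F} (h : a ≠ 0 ∨ b ≠ 0) :
    LinearMap.trace ℂ (State F n) (errorOp a b) = 0 := by
  obtain ⟨a₀, b₀, h₀⟩ := exists_symplectic_ne_zero h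
  obtain ⟨r, hr⟩ := exists_traceChar_symplectic_ne_one h₀
  generalize r • a₀ = a', r • b₀ = b' at hr
  have h1 : errorOp a' b' * errorOp (-a') (-b') = traceChar F (b' ⬝ᵥ -a') • 1 := by
    rw [errorOp_mul, add_neg_cancel, add_neg_cancel, errorOp_zero]
  have h2 : errorOp (-a') (-b') * errorOp a' b' = traceChar F (b' ⬝ᵥ -a') • 1 := by
    rw [errorOp_mul, neg_add_cancel, neg_add_cancel, errorOp_zero, neg_dotProduct, dotProduct_neg]
  have h3 := LinearMap.trace_mul_comm ℂ (errorOp (-a') (-b')) (errorOp a b * errorOp a' b')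
  rw [mul_assoc, h1, errorOp_commute, mul_smul_comm, ← mul_assoc, h2] at h3
  simp only [mul_smul_comm, mul_one, smul_mul_assoc, one_mul, map_smul, smul_eq_mul] at h3
  have h4 : traceChar F (b' ⬝ᵥ -a') ≠ 0 := by
    intro h0
    have := star_traceChar (F := F) (b' ⬝ᵥ -a')
    rw [h0, mul_zero] at this
    exact zero_ne_one this
  rw [mul_left_comm] at h3
  have h5 := mul_left_cancel₀ h4 h3
  by_contra h6
  exact hr (mul_right_cancel₀ h6 (h5.trans (one_mul _).symm))

end ErrorOperators

section StabilizerConstruction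

variable {F : Type*} [Field F] [Finite F] {n : ℕ}

/-- A subspace of `F ^ n × F ^ n` is isotropic if the symplectic form vanishes on it. -/
def IsIsotropic (A : Submodule F ((Fin n → F) × (Fin n → F))) : Prop :=
  ∀ u ∈ A, ∀ v ∈ A, u.2 ⬝ᵥ v.1 = v.2 ⬝ᵥ u.1

/-- In odd characteristic, the phases `χ (a · b / 2)` turn the error operators of an isotropic
subspace into a representation. -/
noncomputable def weylRep (h2 : (2 : F) ≠ 0) {A : Submodule F ((Fin n → F) × (Fin n → F))}
    (hA : IsIsotropic A) : Representation ℂ (Multiplicative A) (State F n) where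
  toFun u := traceChar F (u.toAdd.1.1 ⬝ᵥ u.toAdd.1.2 / 2) • errorOp u.toAdd.1.1 u.toAdd.1.2
  map_one' := by simp [errorOp_zero]
  map_mul' u v := by
    obtain ⟨⟨a, b⟩, hu⟩ := u
    obtain ⟨⟨a', b'⟩, hv⟩ := v
    have h := hA _ hu _ hv
    change traceChar F ((a + a') ⬝ᵥ (b + b') / 2) • errorOp (a + a') (b + b') =
      (traceChar F (a ⬝ᵥ b / 2) • errorOp a b) * (traceChar F (a' ⬝ᵥ b' / 2) • errorOp a' b')
    simp only at h
    rw [smul_mul_smul_comm, errorOp_mul, smul_smul, ← AddChar.map_add_eq_mul,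
      ← AddChar.map_add_eq_mul]
    congr 2
    rw [add_dotProduct, dotProduct_add, dotProduct_add, dotProduct_comm a b', ← h,
      dotProduct_comm a' b]
    field_simp
    ring

theorem weylRep_apply (h2 : (2 : F) ≠ 0) {A : Submodule F ((Fin n → F) × (Fin n → F))}
    (hA : IsIsotropic A) (u : A) :
    weylRep h2 hA (Multiplicative.ofAdd u) =
      traceChar F (u.1.1 ⬝ᵥ u.1.2 / 2) • errorOp u.1.1 u.1.2 := rfl

/-- The average over the group projects onto the invariants, so its trace is their dimension; only
the identity contributes, with trace `q ^ n`. -/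
theorem finrank_invariants_weylRep [Fintype F] (h2 : (2 : F) ≠ 0)
    {A : Submodule F ((Fin n → F) × (Fin n → F))} (hA : IsIsotropic A) :
    Nat.card A * Module.finrank ℂ (weylRep h2 hA).invariants = Fintype.card F ^ n := by
  classical
  have : Fintype A := Fintype.ofFinite A
  have hc : (Fintype.card (Multiplicative A) : ℂ) ≠ 0 := by
    exact_mod_cast Fintype.card_ne_zero
  let : Invertible (Fintype.card (Multiplicative A) : ℂ) := invertibleOfNonzero hc
  have h := ((weylRep h2 hA).isProj_averageMap).trace
  have h1 : ∀ u : A, LinearMap.trace ℂ (State F n) (weylRep h2 hA (Multiplicative.ofAdd u)) =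
      if u = 0 then (Fintype.card F : ℂ) ^ n else 0 := by
    intro u
    rw [weylRep_apply, map_smul]
    split_ifs with hu
    · subst hu
      simp [errorOp_zero]
    · rw [trace_errorOp_eq_zero, smul_zero]
      by_contra! h0
      exact hu (Subtype.ext (Prod.ext h0.1 h0.2))
  rw [Representation.averageMap, GroupAlgebra.average, map_smul, map_sum, map_smul, map_sum] at h
  simp only [Representation.asAlgebraHom_of] at h
  rw [← Equiv.sum_comp Multiplicative.ofAdd] at h
  simp only [h1, Finset.sum_ite_eq', Finset.mem_univ, if_true, invOf_eq_inv, smul_eq_mul] at h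
  rw [inv_mul_eq_iff_eq_mul₀ hc] at h
  rw [Fintype.card_congr Multiplicative.toAdd] at h
  rw [Nat.card_eq_fintype_card]
  exact_mod_cast h.symm

theorem isStabilizerCode_invariants_weylRep [Fintype F] (h2 : (2 : F) ≠ 0)
    {A : Submodule F ((Fin n → F) × (Fin n → F))} (hA : IsIsotropic A) :
    IsStabilizerCode (weylRep h2 hA).invariants := by
  constructor
  · intro h
    have := finrank_invariants_weylRep h2 hA
    rw [h, finrank_bot, mul_zero] at this
    exact (pow_pos Fintype.card_pos n).ne this
  · refine ⟨(MonoidHom.toHomUnits (weylRep h2 hA)).range, ?_, ?_, fun φ => ?_⟩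
    · rintro _ ⟨u, rfl⟩
      obtain ⟨c, hc⟩ := exists_traceChar_eq_pow (u.toAdd.1.1 ⬝ᵥ u.toAdd.1.2 / 2)
      exact ⟨c, u.toAdd.1.1, u.toAdd.1.2, by rw [← hc]; rfl⟩
    · rintro _ ⟨u, rfl⟩ _ ⟨v, rfl⟩
      rw [← map_mul, ← map_mul, mul_comm]
    · rw [Representation.mem_invariants]
      constructor
      · rintro h _ ⟨u, rfl⟩
        exact h u
      · intro h u
        exact h _ ⟨u, rfl⟩

/-- A stabilizer element `g` fixes `φ` and `ψ`, is unitary, and commutes with the error up to a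
scalar `≠ 1`. Inserting `g` on both sides multiplies the inner product by that scalar. -/
theorem errorOp_orthogonal_of_not_commute [Fintype F] (h2 : (2 : F) ≠ 0)
    {A : Submodule F ((Fin n → F) × (Fin n → F))} (hA : IsIsotropic A) {a b : Fin n → F}
    {v : (Fin n → F) × (Fin n → F)} (hv : v ∈ A) (h : b ⬝ᵥ v.1 ≠ v.2 ⬝ᵥ a)
    {φ ψ : State F n} (hφ : φ ∈ (weylRep h2 hA).invariants)
    (hψ : ψ ∈ (weylRep h2 hA).invariants) : star φ ⬝ᵥ errorOp a b ψ = 0 := by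
  -- The symplectic product may be nonzero and yet have trace zero; `A` is closed under `F`-scaling,
  -- so a multiple of `v` is detected by the character.
  obtain ⟨r, hr⟩ := exists_traceChar_symplectic_ne_one (sub_ne_zero.mpr h)
  have hw : r • v ∈ A := A.smul_mem r hv
  have hφ' := hφ (Multiplicative.ofAdd ⟨_, hw⟩)
  have hψ' := hψ (Multiplicative.ofAdd ⟨_, hw⟩)
  rw [weylRep_apply] at hφ' hψ'
  simp only [Prod.smul_fst, Prod.smul_snd, LinearMap.smul_apply] at hφ' hψ'
  generalize r • v.1 = a', r • v.2 = b' at hr hφ' hψ'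
  set z := traceChar F (a' ⬝ᵥ b' / 2) with hz
  have hzz : star z * z = 1 := star_traceChar _
  have key : star φ ⬝ᵥ errorOp a b ψ =
      traceChar F (b ⬝ᵥ a' - b' ⬝ᵥ a) * (star φ ⬝ᵥ errorOp a b ψ) := by
    have hc := congrArg (fun T => T ψ) (errorOp_commute a b a' b')
    simp only [Module.End.mul_apply, LinearMap.smul_apply] at hc
    calc star φ ⬝ᵥ errorOp a b ψ
        = star (z • errorOp a' b' φ) ⬝ᵥ errorOp a b (z • errorOp a' b' ψ) := by rw [hφ', hψ']
      _ = (star z * z) * (traceChar F (b ⬝ᵥ a' - b' ⬝ᵥ a) *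
            (star (errorOp a' b' φ) ⬝ᵥ errorOp a' b' (errorOp a b ψ))) := by
          rw [map_smul, hc, star_smul, smul_dotProduct, dotProduct_smul, dotProduct_smul]
          simp only [smul_eq_mul]
          ring
      _ = _ := by rw [hzz, one_mul, errorOp_star_dotProduct]
  by_contra h6
  exact hr (mul_right_cancel₀ h6 (key.symm.trans (one_mul _).symm))

theorem minDistAtLeast_invariants_weylRep [Fintype F] (h2 : (2 : F) ≠ 0)
    {A : Submodule F ((Fin n → F) × (Fin n → F))} (hA : IsIsotropic A) {d : ℕ}
    (hd : ∀ a b : Fin n → F, 0 < errorWeight a b → errorWeight a b < d →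
      ∃ v ∈ A, b ⬝ᵥ v.1 ≠ v.2 ⬝ᵥ a) :
    MinDistAtLeast (weylRep h2 hA).invariants d := by
  constructor
  · intro a b hab
    rcases Nat.eq_zero_or_pos (errorWeight a b) with h0 | h0
    · obtain ⟨rfl, rfl⟩ := errorWeight_eq_zero.mp h0
      exact ⟨1, fun φ _ ψ _ => by rw [errorOp_zero, Module.End.one_apply, one_mul]⟩
    · obtain ⟨v, hv, h⟩ := hd a b h0 hab
      exact ⟨0, fun φ hφ ψ hψ => by
        rw [errorOp_orthogonal_of_not_commute h2 hA hv h hφ hψ, zero_mul]⟩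
  · intro _ a b h0 hab φ hφ ψ hψ
    obtain ⟨v, hv, h⟩ := hd a b h0 hab
    exact errorOp_orthogonal_of_not_commute h2 hA hv h hφ hψ

end StabilizerConstruction

end GMCC

/-! ### From Hermitian self-orthogonal codes to stabilizer codes. -/

namespace GMCC

/-- `F` and `K` are given independently; both have the same characteristic, and the degree of `F`
over the prime field divides that of `K`. -/
theorem nonempty_ringHom_of_card_eq_sq (F K : Type*) [Field F] [Fintype F] [Field K] [Fintype K]
    (h : Fintype.card K = Fintype.card F ^ 2) : Nonempty (F →+* K) := by
  have : Fact (ringChar F).Prime := ⟨CharP.char_is_prime F (ringChar F)⟩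
  let _ : Algebra (ZMod (ringChar F)) F := ZMod.algebra F (ringChar F)
  have hF := FiniteField.pow_finrank_eq_card (ringChar F) (k := F)
  have : CharP K (ringChar F) := by
    obtain ⟨r, hp, hc⟩ := FiniteField.card K (ringChar K)
    have hdvd : ringChar F ∣ ringChar K ^ (r : ℕ) := by
      rw [← hc, h, ← hF]
      exact dvd_pow (dvd_pow_self _ Module.finrank_pos.ne') two_ne_zero
    have heq := (Nat.prime_dvd_prime_iff_eq Fact.out hp).mp
      ((Fact.out : (ringChar F).Prime).dvd_of_dvd_pow hdvd)
    rw [heq]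
    infer_instance
  let _ : Algebra (ZMod (ringChar F)) K := ZMod.algebra K (ringChar F)
  have hK := FiniteField.pow_finrank_eq_card (ringChar F) (k := K)
  rw [h, ← hF, ← pow_mul] at hK
  have hrank := Nat.pow_right_injective (Fact.out : (ringChar F).Prime).two_le hK
  obtain ⟨f⟩ := FiniteField.nonempty_algHom_of_finrank_dvd (F := ZMod (ringChar F))
    (K := F) (L := K) (Dvd.intro _ hrank.symm)
  exact ⟨f.toRingHom⟩

section HermitianConstruction

variable {F K : Type*} [Field F] [Field K] [Algebra F K]
  {ι : Type*} {n : ℕ}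

/-- The map `(a, b) ↦ a + δ b`, with coordinates relabelled along `e`. -/
def pairMap (δ : K) (e : ι ≃ Fin n) : ((Fin n → F) × (Fin n → F)) →ₗ[F] (ι → K) where
  toFun u := fun i => algebraMap F K (u.1 (e i)) + δ * algebraMap F K (u.2 (e i))
  map_add' u v := by
    funext i
    simp only [Prod.fst_add, Prod.snd_add, Pi.add_apply, map_add]
    ring
  map_smul' r u := by
    funext i
    simp only [Prod.smul_fst, Prod.smul_snd, Pi.smul_apply, smul_eq_mul, map_mul,
      RingHom.id_apply, Algebra.smul_def (A := K)]
    ring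

theorem pairMap_apply (δ : K) (e : ι ≃ Fin n) (u : (Fin n → F) × (Fin n → F)) (i : ι) :
    pairMap δ e u i = algebraMap F K (u.1 (e i)) + δ * algebraMap F K (u.2 (e i)) := rfl

theorem hammingNorm_pairMap_le [Fintype ι] [DecidableEq K] (δ : K) (e : ι ≃ Fin n)
    (u : (Fin n → F) × (Fin n → F)) :
    hammingNorm (pairMap δ e u) ≤ errorWeight u.1 u.2 := by
  classical
  rw [errorWeight, hammingNorm, hammingNorm]
  refine Finset.card_le_card_of_injOn e (fun i hi => ?_) e.injective.injOn
  simp only [Finset.coe_filter, Finset.mem_univ, true_and, Set.mem_ofPred_eq] at hi ⊢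
  intro h
  rw [Prod.mk_eq_zero] at h
  exact hi (by rw [pairMap_apply, h.1, h.2, map_zero, mul_zero, add_zero])

variable [Fintype F]

theorem add_pow_card (x y : K) :
    (x + y) ^ Fintype.card F = x ^ Fintype.card F + y ^ Fintype.card F :=
  map_add (FiniteField.frobeniusAlgHom F K) x y

theorem algebraMap_pow_card (x : F) :
    algebraMap F K x ^ Fintype.card F = algebraMap F K x :=
  (FiniteField.frobeniusAlgHom F K).commutes x

theorem sum_pow_card {s : Type*} [Fintype s] (f : s → K) :
    (∑ i, f i) ^ Fintype.card F = ∑ i, f i ^ Fintype.card F :=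
  map_sum (FiniteField.frobeniusAlgHom F K) f Finset.univ

/-- Applying `z ↦ z ^ q` also gives `x - δ y = 0`; subtract. -/
theorem add_mul_algebraMap_eq_zero {δ : K} (hδ : δ ^ Fintype.card F = -δ) (hδ0 : δ ≠ 0)
    (h2 : (2 : K) ≠ 0) {x y : F} (h : algebraMap F K x + δ * algebraMap F K y = 0) :
    x = 0 ∧ y = 0 := by
  have h' := congrArg (fun z => z ^ Fintype.card F) h
  simp only [add_pow_card, mul_pow, algebraMap_pow_card, hδ] at h'
  rw [zero_pow Fintype.card_ne_zero] at h'
  have hy : (2 * δ) * algebraMap F K y = 0 := by linear_combination h - h'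
  have hy := (mul_eq_zero.mp hy).resolve_left (mul_ne_zero h2 hδ0)
  rw [hy, mul_zero, add_zero] at h
  exact ⟨(map_eq_zero _).mp h, (map_eq_zero _).mp hy⟩

theorem pairMap_injective {δ : K} (hδ : δ ^ Fintype.card F = -δ) (hδ0 : δ ≠ 0)
    (h2 : (2 : K) ≠ 0) (e : ι ≃ Fin n) :
    Function.Injective (pairMap (F := F) δ e) := by
  rw [← LinearMap.ker_eq_bot, LinearMap.ker_eq_bot']
  intro u hu
  have h : ∀ i, u.1 i = 0 ∧ u.2 i = 0 := fun i =>
    add_mul_algebraMap_eq_zero hδ hδ0 h2 (by simpa [pairMap_apply] using congrFun hu (e.symm i))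
  exact Prod.ext (funext fun i => (h i).1) (funext fun i => (h i).2)

variable [Fintype K]

theorem pairMap_bijective [Fintype ι] (hK : Fintype.card K = Fintype.card F ^ 2) {δ : K}
    (hδ : δ ^ Fintype.card F = -δ) (hδ0 : δ ≠ 0) (h2 : (2 : K) ≠ 0) (e : ι ≃ Fin n) :
    Function.Bijective (pairMap (F := F) δ e) := by
  classical
  rw [Fintype.bijective_iff_injective_and_card]
  refine ⟨pairMap_injective hδ hδ0 h2 e, ?_⟩
  rw [Fintype.card_prod, Fintype.card_fun, Fintype.card_fun, hK, Fintype.card_congr e,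
    Fintype.card_fin, ← pow_mul, ← pow_add, two_mul]

/-- The Hermitian form determines the symplectic one. -/
theorem hermitian_sub_pow_card [Fintype ι] (hK : Fintype.card K = Fintype.card F ^ 2) {δ : K}
    (hδ : δ ^ Fintype.card F = -δ) (e : ι ≃ Fin n) (u v : (Fin n → F) × (Fin n → F)) :
    (∑ i, pairMap δ e u i * pairMap δ e v i ^ Fintype.card F) -
        (∑ i, pairMap δ e u i * pairMap δ e v i ^ Fintype.card F) ^ Fintype.card F =
      2 * δ * algebraMap F K (u.2 ⬝ᵥ v.1 - v.2 ⬝ᵥ u.1) := by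
  have hpp : ∀ x : K, (x ^ Fintype.card F) ^ Fintype.card F = x := fun x => by
    rw [← pow_mul, ← sq, ← hK, FiniteField.pow_card]
  rw [sum_pow_card (F := F), ← Finset.sum_sub_distrib]
  simp only [dotProduct, map_sub, map_sum, map_mul]
  rw [← Equiv.sum_comp e, ← Equiv.sum_comp e, ← Finset.sum_sub_distrib, Finset.mul_sum]
  refine Finset.sum_congr rfl fun i _ => ?_
  rw [mul_pow, hpp]
  simp only [pairMap_apply, add_pow_card, mul_pow, algebraMap_pow_card, hδ]
  ring

omit [Fintype K] in
theorem span_le_hermitianDual [Fintype ι] {S : Set (ι → K)}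
    (h : ∀ x ∈ S, ∀ y ∈ S, ∑ i, x i * y i ^ Fintype.card F = 0) :
    Submodule.span K S ≤ hermitianDual (Fintype.card F) (Submodule.span K S) := by
  rw [Submodule.span_le]
  intro x hx c hc
  induction hc using Submodule.span_induction with
  | mem y hy => exact h x hx y hy
  | zero => simp
  | add y z _ _ hy hz =>
    simp only [Pi.add_apply, add_pow_card, mul_add, Finset.sum_add_distrib]
    rw [hy, hz, add_zero]
  | smul r y _ hy =>
    simp only [Pi.smul_apply, smul_eq_mul, mul_pow, mul_left_comm _ (r ^ Fintype.card F)]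
    rw [← Finset.mul_sum, hy, mul_zero]

/-- The Hermitian construction of stabilizer codes, in odd characteristic. -/
theorem existsStabilizerCode_of_le_hermitianDual [Fintype ι] [DecidableEq K]
    (hK : Fintype.card K = Fintype.card F ^ 2) {δ : K}
    (hδ : δ ^ Fintype.card F = -δ) (hδ0 : δ ≠ 0) (h2 : (2 : F) ≠ 0) (e : ι ≃ Fin n)
    {C : Submodule K (ι → K)} (hC : C ≤ hermitianDual (Fintype.card F) C) {d : ℕ}
    (hd : ∀ x ∈ hermitianDual (Fintype.card F) C, hammingNorm x < d → x = 0) :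
    2 * Module.finrank K C ≤ n ∧ ExistsStabilizerCode F n (n - 2 * Module.finrank K C) d := by
  have h2K : (2 : K) ≠ 0 := by
    intro h
    apply h2
    rw [← map_ofNat (algebraMap F K) 2] at h
    exact (map_eq_zero _).mp h
  have hbij := pairMap_bijective hK hδ hδ0 h2K e
  let A := (C.restrictScalars F).comap (pairMap δ e)
  have hA : IsIsotropic A := by
    intro u hu v hv
    have h := hermitian_sub_pow_card hK hδ e u v
    rw [hC (show pairMap δ e u ∈ C from hu) _ (show pairMap δ e v ∈ C from hv),
      zero_pow Fintype.card_ne_zero, sub_zero] at h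
    have h := (mul_eq_zero.mp h.symm).resolve_left (mul_ne_zero h2K hδ0)
    exact sub_eq_zero.mp ((map_eq_zero _).mp h)
  have hcard : Nat.card A = Fintype.card F ^ (2 * Module.finrank K C) := by
    rw [pow_mul, ← hK, ← Nat.card_eq_fintype_card, ← Module.natCard_eq_pow_finrank (K := K)]
    refine Nat.card_congr (Equiv.ofBijective (fun u : A => (⟨pairMap δ e u.1, u.2⟩ : C)) ⟨?_, ?_⟩)
    · intro u v h
      exact Subtype.ext (hbij.1 (congrArg Subtype.val h))
    · rintro ⟨c, hc⟩
      obtain ⟨u, rfl⟩ := hbij.2 c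
      exact ⟨⟨u, hc⟩, rfl⟩
  have hprod := finrank_invariants_weylRep h2 hA
  rw [hcard] at hprod
  -- The trace formula gives `q ^ (2 dim C) ∣ q ^ n`.
  have hdim : 2 * Module.finrank K C ≤ n :=
    (Nat.pow_dvd_pow_iff_le_right (Fintype.one_lt_card (α := F))).mp (Dvd.intro _ hprod)
  refine ⟨hdim, (weylRep h2 hA).invariants, isStabilizerCode_invariants_weylRep h2 hA, ?_,
    minDistAtLeast_invariants_weylRep h2 hA ?_⟩
  · refine Nat.eq_of_mul_eq_mul_left (pow_pos (Fintype.card_pos (α := F)) _) (hprod.trans ?_)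
    rw [← pow_add, Nat.add_sub_cancel' hdim]
  · intro a b h0 hab
    by_contra! hcon
    have hcomm : ∀ c ∈ C, (∑ i, pairMap δ e (a, b) i * c i ^ Fintype.card F) =
        (∑ i, pairMap δ e (a, b) i * c i ^ Fintype.card F) ^ Fintype.card F := by
      intro c hc
      obtain ⟨v, rfl⟩ := hbij.2 c
      have h := hermitian_sub_pow_card hK hδ e (a, b) v
      rw [hcon v hc, sub_self, map_zero, mul_zero] at h
      exact sub_eq_zero.mp h
    have hmem : pairMap δ e (a, b) ∈ hermitianDual (Fintype.card F) C := by
      intro c hc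
      have h1 := hcomm c hc
      -- Commutation only says that `H = H ^ q`. The same for `δ c`, whose product is `-δ H`, gives
      -- `-δ H = δ H`, so `H = 0`.
      have h3 := hcomm (δ • c) (C.smul_mem δ hc)
      simp only [Pi.smul_apply, smul_eq_mul, mul_pow, hδ, mul_left_comm _ (-δ)] at h3
      rw [← Finset.mul_sum] at h3
      set H := ∑ i, pairMap δ e (a, b) i * c i ^ Fintype.card F
      have hneg : (-δ) ^ Fintype.card F = δ := by
        rw [← hδ, ← pow_mul, ← sq, ← hK, FiniteField.pow_card]
      rw [mul_pow, hneg, ← h1] at h3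
      have : (2 * δ) * H = 0 := by linear_combination -h3
      exact (mul_eq_zero.mp this).resolve_left (mul_ne_zero h2K hδ0)
    have h := hd _ hmem ((hammingNorm_pairMap_le δ e (a, b)).trans_lt hab)
    have h := hbij.1 (h.trans (map_zero _).symm)
    exact h0.ne' (errorWeight_eq_zero.mpr (Prod.mk_eq_zero.mp h))

end HermitianConstruction

end GMCC

/-! ### The footprint bound and evaluation codes. -/

namespace GMCC

theorem linearIndepOn_of_notMem_span_Iio {R V α : Type*} [Field R] [AddCommGroup V] [Module R V]
    [LinearOrder α] {v : α → V} (s : Finset α)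
    (h : ∀ x ∈ s, v x ∉ Submodule.span R (v '' Set.Iio x)) :
    LinearIndepOn R v (s : Set α) := by
  induction s using Finset.induction_on_max with
  | empty => simp
  | insert x s hx ih =>
    rw [Finset.coe_insert]
    refine (ih fun y hy => h y (Finset.mem_insert_of_mem hy)).insert ?_
    intro hmem
    exact h x (Finset.mem_insert_self _ _)
      (Submodule.span_mono (Set.image_mono fun y hy => hx y hy) hmem)

section StandardMonomials

variable {K σ T : Type*} [Field K] [Fintype σ]

/-- The function `∏ j, g j ^ e j` given by the monomial `X ^ e`. -/
def monomialFun (g : σ → T → K) (e : σ → ℕ) : T → K := ∏ j, g j ^ e j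

theorem monomialFun_add (g : σ → T → K) (e f : σ → ℕ) :
    monomialFun g (e + f) = monomialFun g e * monomialFun g f := by
  simp only [monomialFun, Pi.add_apply, pow_add, Finset.prod_mul_distrib]

theorem monomialFun_single [DecidableEq σ] (g : σ → T → K) (j : σ) (i : ℕ) :
    monomialFun g (Pi.single j i) = g j ^ i := by
  rw [monomialFun, Finset.prod_eq_single j]
  · rw [Pi.single_eq_same]
  · intro k _ hk
    rw [Pi.single_eq_of_ne hk, pow_zero]
  · simp

/-- Interpolation: the coordinates separate points, so products of factors `g j - g j t` yield the
indicator of each point. -/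
theorem span_range_monomialFun_eq_top [Finite T] {g : σ → T → K}
    (hg : Function.Injective fun t j => g j t) :
    Submodule.span K (Set.range (monomialFun g)) = ⊤ := by
  classical
  have := Fintype.ofFinite T
  let M : Submonoid (T → K) :=
    { carrier := Set.range (monomialFun g)
      one_mem' := ⟨0, by simp [monomialFun]⟩
      mul_mem' := by
        rintro _ _ ⟨e, rfl⟩ ⟨f, rfl⟩
        exact ⟨e + f, monomialFun_add g e f⟩ }
  have hM : Subalgebra.toSubmodule (Algebra.adjoin K (M : Set (T → K))) =
      Submodule.span K (Set.range (monomialFun g)) := by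
    rw [Algebra.adjoin_eq_span, Submonoid.closure_eq]
    rfl
  rw [← hM, Algebra.toSubmodule_eq_top, Algebra.eq_top_iff]
  have hgen : ∀ j, g j ∈ Algebra.adjoin K (M : Set (T → K)) := fun j =>
    Algebra.subset_adjoin ⟨Pi.single j 1, by rw [monomialFun_single, pow_one]⟩
  have hsingle : ∀ t₀ : T, (Pi.single t₀ 1 : T → K) ∈ Algebra.adjoin K (M : Set (T → K)) := by
    intro t₀
    have hsep : ∀ t : T, ∃ f ∈ Algebra.adjoin K (M : Set (T → K)),
        f t₀ ≠ 0 ∧ (t ≠ t₀ → f t = 0) := by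
      intro t
      by_cases ht : t = t₀
      · exact ⟨1, one_mem _, one_ne_zero, fun h => absurd ht h⟩
      · obtain ⟨j, hj⟩ := Function.ne_iff.mp (hg.ne ht)
        refine ⟨g j - algebraMap K (T → K) (g j t), sub_mem (hgen j) (Subalgebra.algebraMap_mem _ _),
          ?_, fun _ => ?_⟩
        · exact sub_ne_zero.mpr (Ne.symm hj)
        · exact sub_self _
    choose f hfA hf₀ hf using hsep
    have hsmul : (Pi.single t₀ 1 : T → K) = ((∏ t, f t) t₀)⁻¹ • ∏ t, f t := by
      funext s
      simp only [Pi.smul_apply, smul_eq_mul, Finset.prod_apply]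
      by_cases hs : s = t₀
      · subst hs
        rw [Pi.single_eq_same, inv_mul_cancel₀ (Finset.prod_ne_zero_iff.mpr fun t _ => hf₀ t)]
      · rw [Pi.single_eq_of_ne hs,
          Finset.prod_eq_zero (f := fun t => f t s) (Finset.mem_univ s) (hf s hs), mul_zero]
    rw [hsmul]
    exact Subalgebra.smul_mem _ (prod_mem fun t _ => hfA t) _
  intro f
  have hf : f = ∑ t, f t • (Pi.single t 1 : T → K) := by
    funext t
    simp [Finset.sum_apply, Pi.single_apply]
  rw [hf]
  exact sum_mem fun t _ => Subalgebra.smul_mem _ (hsingle t) _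

variable [LinearOrder σ]

/-- The exponents that are standard for the vanishing ideal of the points, with respect to the
lexicographic order. -/
def standardExponents (g : σ → T → K) : Set (σ → ℕ) :=
  {e | monomialFun g e ∉ Submodule.span K ((fun d => monomialFun g (ofLex d)) '' Set.Iio (toLex e))}

/-- A nonstandard monomial reduces to lexicographically smaller ones, and this order on `σ → ℕ` is
well-founded. -/
theorem span_standardExponents_eq_top [Finite T] {g : σ → T → K}
    (hg : Function.Injective fun t j => g j t) :
    Submodule.span K (monomialFun g '' standardExponents g) = ⊤ := by
  rw [eq_top_iff, ← span_range_monomialFun_eq_top hg, Submodule.span_le]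
  rintro _ ⟨e, rfl⟩
  have key : ∀ e : Lex (σ → ℕ), monomialFun g (ofLex e) ∈
      Submodule.span K (monomialFun g '' standardExponents g) := by
    intro e
    induction e using WellFoundedLT.induction with
    | ind e ih =>
      by_cases he : ofLex e ∈ standardExponents g
      · exact Submodule.subset_span ⟨_, he, rfl⟩
      · refine Submodule.span_le.mpr ?_ (not_not.mp he)
        rintro _ ⟨d, hd, rfl⟩
        exact ih d hd
  exact key (toLex e)

/-- A reduction of `X ^ d` multiplied by `X ^ (e - d)` is a reduction of `X ^ e`, because the order
is compatible with addition. -/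
theorem mem_standardExponents_of_le {g : σ → T → K} {d e : σ → ℕ} (hde : d ≤ e)
    (he : e ∈ standardExponents g) : d ∈ standardExponents g := by
  by_contra hd
  refine he ?_
  obtain ⟨f, rfl⟩ := exists_add_of_le hde
  have h := Submodule.mem_map_of_mem (f := LinearMap.mulRight K (monomialFun g f)) (not_not.mp hd)
  rw [Submodule.map_span, ← Set.image_comp, LinearMap.mulRight_apply, ← monomialFun_add] at h
  refine Submodule.span_mono ?_ h
  rintro _ ⟨c, hc, rfl⟩
  refine ⟨c + toLex f, ?_, ?_⟩
  · rw [Set.mem_Iio, toLex_add]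
    exact add_lt_add_left hc _
  · rw [Function.comp_apply, LinearMap.mulRight_apply, ← monomialFun_add]
    rfl

/-- All exponents `d ≤ e` are standard, so they give `∏ (e j + 1)` linearly independent functions on
`T`. -/
theorem prod_add_one_le_card_of_mem_standardExponents [Fintype T] {g : σ → T → K} {e : σ → ℕ}
    (he : e ∈ standardExponents g) : ∏ j, (e j + 1) ≤ Fintype.card T := by
  have hind : LinearIndepOn K (fun d : Lex (σ → ℕ) => monomialFun g (ofLex d))
      (((Finset.Iic e).map toLex.toEmbedding : Finset (Lex (σ → ℕ))) : Set (Lex (σ → ℕ))) := by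
    refine linearIndepOn_of_notMem_span_Iio _ fun x hx => ?_
    rw [Finset.mem_map_equiv, Finset.mem_Iic] at hx
    exact mem_standardExponents_of_le hx he
  have h := LinearIndependent.fintype_card_le_finrank hind
  rw [Module.finrank_fintype_fun_eq_card] at h
  have hcard : ((Finset.Iic e).map toLex.toEmbedding).card ≤ Fintype.card T := by
    rw [← Fintype.card_coe]
    exact h
  rw [Finset.card_map, Pi.card_Iic] at hcard
  simpa using hcard

theorem lt_of_mem_standardExponents {g : σ → T → K} {e : σ → ℕ} (he : e ∈ standardExponents g)
    {j : σ} {p : Polynomial K} (hp : p.Monic) (hpg : ∀ t, p.eval (g j t) = 0) :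
    e j < p.natDegree := by
  by_contra! hle
  have hmem : (Pi.single j p.natDegree : σ → ℕ) ∈ standardExponents g := by
    refine mem_standardExponents_of_le (fun k => ?_) he
    rcases eq_or_ne k j with rfl | hk
    · rwa [Pi.single_eq_same]
    · rw [Pi.single_eq_of_ne hk]
      exact Nat.zero_le _
  refine hmem ?_
  have hpow : monomialFun g (Pi.single j p.natDegree) =
      -∑ i ∈ Finset.range p.natDegree, p.coeff i • monomialFun g (Pi.single j i) := by
    funext t
    have h := hpg t
    rw [hp.as_sum] at h
    simp only [Polynomial.eval_add, Polynomial.eval_pow, Polynomial.eval_X,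
      Polynomial.eval_finsetSum, Polynomial.eval_mul, Polynomial.eval_C] at h
    simp only [monomialFun_single, Pi.neg_apply, Finset.sum_apply, Pi.smul_apply, Pi.pow_apply,
      smul_eq_mul]
    exact eq_neg_of_add_eq_zero_left h
  rw [hpow]
  refine neg_mem (sum_mem fun i hi => Submodule.smul_mem _ _ (Submodule.subset_span
    ⟨toLex (Pi.single j i), ?_, rfl⟩))
  exact Pi.toLex_strictMono (Pi.single_strictMono j (Finset.mem_range.mp hi))

/-- The functions on a finite set of points are spanned by the monomials `X ^ e` for which
`∏ j, (e j + 1)` does not exceed the number of points. -/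
theorem span_monomialFun_eq_top [Fintype T] {g : σ → T → K}
    (hg : Function.Injective fun t j => g j t) (a : σ → ℕ)
    (ha : ∀ j, ∃ p : Polynomial K, p.Monic ∧ p.natDegree = a j ∧ ∀ t, p.eval (g j t) = 0) :
    Submodule.span K (monomialFun g ''
      {e | (∀ j, e j < a j) ∧ ∏ j, (e j + 1) ≤ Fintype.card T}) = ⊤ := by
  rw [eq_top_iff, ← span_standardExponents_eq_top hg]
  refine Submodule.span_mono (Set.image_mono fun e he => ⟨fun j => ?_,
    prod_add_one_le_card_of_mem_standardExponents he⟩)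
  obtain ⟨p, hp, hpa, hpg⟩ := ha j
  exact hpa ▸ lt_of_mem_standardExponents he hp hpg

end StandardMonomials

section EvaluationCodes

variable {K : Type*} [Field K] {m : ℕ} {a : Fin m → ℕ} {ξ : (j : Fin m) → Fin (a j) → K}
  {v : Box a → K}

/-- The footprint bound at the points indexed by `T`; the nonvanishing twist acts on functions as an
invertible diagonal map. -/
theorem map_code_eq_top {T : Type*} [Fintype T] {τ : T → Box a} (hτ : Function.Injective τ)
    (hξ : ∀ j, Function.Injective (ξ j)) (hv : ∀ α, v α ≠ 0) {Δ : Finset (Box a)}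
    (hΔ : ∀ e : Box a, ∏ j, ((e j : ℕ) + 1) ≤ Fintype.card T → e ∈ Δ) :
    (code ξ v Δ).map (LinearMap.funLeft K K τ) = ⊤ := by
  let g : Fin m → T → K := fun j t => ξ j (τ t j)
  have hg : Function.Injective fun t j => g j t := fun s t h =>
    hτ (funext fun j => hξ j (congrFun h j))
  have hspan := span_monomialFun_eq_top hg a fun j =>
    ⟨∏ s, (Polynomial.X - Polynomial.C (ξ j s)), Polynomial.monic_prod_X_sub_C _ _, by simp,
      fun t => by
        rw [Polynomial.eval_prod]
        exact Finset.prod_eq_zero (Finset.mem_univ (τ t j)) (by simp [g])⟩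
  rw [eq_top_iff]
  intro f _
  let D : (T → K) →ₗ[K] (T → K) := LinearMap.mulLeft K fun t => v (τ t)
  have hf : (fun t => (v (τ t))⁻¹ * f t) ∈ (⊤ : Submodule K (T → K)) := trivial
  rw [← hspan] at hf
  have hDf := Submodule.mem_map_of_mem (f := D) hf
  have hDf' : D (fun t => (v (τ t))⁻¹ * f t) = f := by
    funext t
    exact mul_inv_cancel_left₀ (hv _) _
  rw [hDf', Submodule.map_span, ← Set.image_comp] at hDf
  rw [code, Submodule.map_span, ← Set.image_comp]
  refine Submodule.span_mono ?_ hDf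
  rintro _ ⟨e, ⟨hea, he⟩, rfl⟩
  refine ⟨fun j => ⟨e j, hea j⟩, hΔ _ he, ?_⟩
  funext t
  simp [D, g, monomialFun, evalMonomial, Finset.prod_apply]

/-- With `T` the whole grid, the monomials span a space whose dimension is their number. -/
theorem linearIndependent_evalMonomial (hξ : ∀ j, Function.Injective (ξ j))
    (hv : ∀ α, v α ≠ 0) : LinearIndependent K (evalMonomial ξ v) := by
  have h := map_code_eq_top (τ := (id : Box a → Box a)) Function.injective_id hξ hv
    (Δ := Finset.univ) fun e _ => Finset.mem_univ e
  rw [show LinearMap.funLeft K K (id : Box a → Box a) = LinearMap.id from rfl,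
    Submodule.map_id, code, Finset.coe_univ, Set.image_univ] at h
  exact linearIndependent_of_top_le_span_of_card_eq_finrank h.ge
    (Module.finrank_fintype_fun_eq_card K).symm

theorem finrank_code (hξ : ∀ j, Function.Injective (ξ j)) (hv : ∀ α, v α ≠ 0)
    (Δ : Finset (Box a)) : Module.finrank K (code ξ v Δ) = Δ.card := by
  have h := (linearIndependent_evalMonomial hξ hv).comp (Subtype.val : Δ → Box a)
    Subtype.val_injective
  have hr : evalMonomial ξ v '' (Δ : Set (Box a)) =
      Set.range (evalMonomial ξ v ∘ (Subtype.val : Δ → Box a)) := by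
    rw [Set.range_comp, Subtype.range_coe]
  rw [code, hr, finrank_span_eq_card h, Fintype.card_coe]

/-- Some codeword restricts on the support of `x` to the indicator of one point; pairing with it
isolates that entry of `x`. -/
theorem eq_zero_of_mem_hermitianDual [DecidableEq K] (hξ : ∀ j, Function.Injective (ξ j))
    (hv : ∀ α, v α ≠ 0) {q : ℕ} (hq : q ≠ 0) {t : ℕ} {x : Box a → K}
    (hx : x ∈ hermitianDual q (code ξ v (hyperbolicSet a t))) (hxt : hammingNorm x < t) :
    x = 0 := by
  by_contra hne
  obtain ⟨α₀, hα₀⟩ := Function.ne_iff.mp hne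
  have h := map_code_eq_top (τ := (Subtype.val : {α // x α ≠ 0} → Box a)) Subtype.val_injective hξ
    hv (Δ := hyperbolicSet a t) fun e he => by
      rw [hyperbolicSet, Finset.mem_filter]
      refine ⟨Finset.mem_univ _, he.trans_lt ?_⟩
      rwa [Fintype.card_subtype]
  have hf : (Pi.single ⟨α₀, hα₀⟩ 1 : {α // x α ≠ 0} → K) ∈
    (⊤ : Submodule K ({α // x α ≠ 0} → K)) := trivial
  rw [← h] at hf
  obtain ⟨c, hc, hcf⟩ := hf
  have hsum := hx c hc
  rw [Finset.sum_eq_single α₀] at hsum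
  · have h1 : c α₀ = 1 := by
      have := congrFun hcf ⟨α₀, hα₀⟩
      rwa [Pi.single_eq_same] at this
    rw [h1, one_pow, mul_one] at hsum
    exact hα₀ hsum
  · intro α _ hα
    by_cases hxα : x α = 0
    · rw [hxα, zero_mul]
    · have : c α = 0 := by
        have := congrFun hcf ⟨α, hxα⟩
        rwa [Pi.single_eq_of_ne (fun h => hα (congrArg Subtype.val h))] at this
      rw [this, zero_pow hq, mul_zero]
  · exact fun h => absurd (Finset.mem_univ _) h

end EvaluationCodes

end GMCC

/-! ### The twist vector and Hermitian self-orthogonality. -/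

namespace GMCC

section TwistVector

variable {m : ℕ} [NeZero m] {a : Fin m → ℕ}

theorem card_filter_apply_zero_lt {k : ℕ} (hk : k ≤ a 0) :
    (Finset.univ.filter fun β : Box a => (β 0 : ℕ) < k).card =
      k * ∏ j ∈ Finset.univ.erase 0, a j := by
  let S : (j : Fin m) → Finset (Fin (a j)) := fun j =>
    Finset.univ.filter fun s => j = 0 → (s : ℕ) < k
  have hS : (Finset.univ.filter fun β : Box a => (β 0 : ℕ) < k) = Fintype.piFinset S := by
    ext β
    simp only [Finset.mem_filter, Finset.mem_univ, true_and, Fintype.mem_piFinset, S]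
    exact ⟨fun h j hj => by subst hj; exact h, fun h => h 0 rfl⟩
  rw [hS, Fintype.card_piFinset, ← Finset.mul_prod_erase _ _ (Finset.mem_univ 0)]
  congr 1
  · simp [S, Fin.card_filter_val_lt, hk]
  · refine Finset.prod_congr rfl fun j hj => ?_
    simp [S, Finset.ne_of_mem_erase hj]

/-- The predecessors of `α` include every `β` with `β 0 < α 0` and form a proper subset of those
with `β 0 ≤ α 0`, as `α` is not one of them. -/
theorem lexPosition_div (α : Box a) :
    lexPosition α / (∏ j ∈ Finset.univ.erase 0, a j) = α 0 := by
  classical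
  have hpos : lexPosition α = (Finset.univ.filter fun β : Box a => toLex β < toLex α).card := by
    rw [lexPosition, ← Set.ncard_coe_finset]
    congr 1
    ext β
    simp
  rw [hpos]
  refine Nat.div_eq_of_lt_le ?_ ?_
  · rw [← card_filter_apply_zero_lt (α 0).isLt.le]
    refine Finset.card_le_card fun β hβ => ?_
    rw [Finset.mem_filter] at hβ ⊢
    exact ⟨hβ.1, 0, fun j hj => absurd hj (Fin.not_lt_zero j), hβ.2⟩
  · rw [← card_filter_apply_zero_lt (Nat.succ_le_of_lt (α 0).isLt)]
    refine Finset.card_lt_card ⟨fun β hβ => ?_, fun h => ?_⟩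
    · rw [Finset.mem_filter] at hβ ⊢
      obtain ⟨i, hi, hlt⟩ := hβ.2
      refine ⟨hβ.1, Nat.lt_succ_of_le ?_⟩
      rcases eq_or_ne i 0 with rfl | h0
      · exact le_of_lt hlt
      · exact (congrArg Fin.val (hi 0 (lt_of_le_of_ne (Fin.zero_le i) h0.symm))).le
    · have := h (Finset.mem_filter.mpr ⟨Finset.mem_univ α, Nat.lt_succ_self _⟩)
      exact lt_irrefl _ (Finset.mem_filter.mp this).2

theorem twistVector_apply {K : Type*} [Field K] {q l : ℕ} (ha : a 0 = l * (q + 1)) (ζ : K)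
    (α : Box a) :
    twistVector q ζ a α = if Even ((α 0 : ℕ) / l) then ζ ^ ((q - 1) / 2) else 1 := by
  have hn : (∏ j, a j) / (q + 1) = (∏ j ∈ Finset.univ.erase 0, a j) * l := by
    rw [← Finset.mul_prod_erase _ _ (Finset.mem_univ 0), ha]
    refine Nat.div_eq_of_eq_mul_left q.succ_pos ?_
    ring
  rw [twistVector, hn, ← Nat.div_div_eq_div_mul, lexPosition_div]

theorem sum_apply_zero_mul_prod {R : Type*} [CommSemiring R] (u : Fin (a 0) → R)
    (f : (j : Fin m) → Fin (a j) → R) :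
    ∑ α : Box a, u (α 0) * ∏ j, f j (α j) =
      (∑ s, u s * f 0 s) * ∏ j ∈ Finset.univ.erase 0, ∑ s, f j s := by
  let w : (j : Fin m) → Fin (a j) → R := Function.update (fun _ _ => 1) 0 u
  have hw0 : w 0 = u := Function.update_self _ _ _
  have hw : ∀ j, j ≠ 0 → ∀ s, w j s = 1 := fun j hj s => by
    simp [w, Function.update_of_ne hj]
  have h := Fintype.prod_sum fun j s => w j s * f j s
  rw [← Finset.mul_prod_erase _ _ (Finset.mem_univ 0), hw0] at h
  rw [Finset.prod_congr rfl fun j hj => Finset.sum_congr rfl fun s _ => by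
    rw [hw j (Finset.ne_of_mem_erase hj), one_mul]] at h
  rw [h]
  refine Finset.sum_congr rfl fun α _ => ?_
  rw [Finset.prod_mul_distrib, Finset.prod_eq_single 0 (fun j _ hj => hw j hj _) (by simp), hw0]

end TwistVector

theorem sum_range_add_of_periodic {M : Type*} [AddCommMonoid M] [IsCancelAdd M] {G : ℕ → M} {N : ℕ}
    (hG : Function.Periodic G N) (l : ℕ) :
    ∑ s ∈ Finset.range N, G (s + l) = ∑ s ∈ Finset.range N, G s := by
  induction l with
  | zero => rfl
  | succ l ih =>
    rw [← ih]
    have h1 := Finset.sum_range_succ' (fun s => G (s + l)) N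
    rw [Finset.sum_range_succ, zero_add, add_comm N l, hG] at h1
    simpa only [add_right_comm, add_assoc] using (add_right_cancel h1).symm

/-- Shifting the summation index by `l` preserves the sum and multiplies it by `-x ^ l`. -/
theorem sum_range_antiperiodic_mul_pow {K : Type*} [Field K] {u : ℕ → K} {x : K} {l N : ℕ}
    (hu : ∀ s, u (s + l) = -u s) (huN : Function.Periodic u N) (hx : x ^ N = 1)
    (hxl : x ^ l ≠ -1) : ∑ s ∈ Finset.range N, u s * x ^ s = 0 := by
  have hper : Function.Periodic (fun s => u s * x ^ s) N := fun s => by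
    simp only [huN s, pow_add, hx, mul_one]
  have h := sum_range_add_of_periodic hper l
  simp only [hu, pow_add] at h
  have h' : -x ^ l * ∑ s ∈ Finset.range N, u s * x ^ s = ∑ s ∈ Finset.range N, u s * x ^ s := by
    rw [Finset.mul_sum]
    exact (Finset.sum_congr rfl fun s _ => by ring).trans h
  have h0 : (x ^ l + 1) * ∑ s ∈ Finset.range N, u s * x ^ s = 0 := by linear_combination -h'
  exact (mul_eq_zero.mp h0).resolve_left fun h1 => hxl (eq_neg_of_add_eq_zero_left h1)

theorem pow_add_mul_ne_neg_one {K : Type*} [Field K] (h2 : (2 : K) ≠ 0) {q : ℕ} {θ : K}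
    (hθ : IsPrimitiveRoot θ (q + 1)) {e e' : ℕ} (he : 2 * e < q + 1) (he' : 2 * e' < q + 1) :
    θ ^ (e + q * e') ≠ -1 := by
  intro h
  have hsq : θ ^ (2 * (e + q * e')) = 1 := by
    rw [mul_comm, pow_mul, h]
    norm_num
  obtain ⟨k, hk⟩ := (hθ.pow_eq_one_iff_dvd _).mp hsq
  -- Modulo `q + 1` one has `q ≡ -1`, so the exponent is `e - e'`.
  have hdvd : ((q : ℤ) + 1) ∣ 2 * ((e : ℤ) - e') := by
    refine ⟨k - 2 * e', ?_⟩
    have hk' : (2 : ℤ) * (e + q * e') = (q + 1) * k := by exact_mod_cast hk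
    linear_combination hk'
  have h0 := Int.eq_zero_of_abs_lt_dvd hdvd (by rw [abs_lt]; omega)
  have heq : e = e' := by omega
  subst heq
  rw [show e + q * e = (q + 1) * e by ring, pow_mul, hθ.pow_eq_one, one_pow] at h
  exact h2 (by linear_combination h)

theorem pow_half_eq_neg_one {K : Type*} [Field K] {q : ℕ} (hq : Odd q) (hq1 : 1 < q) {ζ : K}
    (hζ : IsPrimitiveRoot ζ (q ^ 2 - 1)) : ζ ^ ((q - 1) / 2 * (q + 1)) = -1 := by
  obtain ⟨k, rfl⟩ := hq
  have hk : 0 < k := by omega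
  have hexp : (2 * k + 1) ^ 2 - 1 = ((2 * k + 1 - 1) / 2 * (2 * k + 1 + 1)) * 2 := by
    rw [Nat.add_sub_cancel, Nat.mul_div_cancel_left _ two_pos]
    refine Nat.sub_eq_of_eq_add ?_
    ring
  rw [hexp] at hζ
  have hpos : 0 < (2 * k + 1 - 1) / 2 * (2 * k + 1 + 1) := by
    rw [Nat.add_sub_cancel, Nat.mul_div_cancel_left _ two_pos]
    positivity
  exact (hζ.pow (by positivity) rfl).eq_neg_one_of_two_right

section SelfOrthogonality

variable {K : Type*} [Field K] {m : ℕ} [NeZero m] {a : Fin m → ℕ}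

theorem sum_evalMonomial_mul_pow_eq_zero (h2 : (2 : K) ≠ 0) {q l : ℕ} (hq : Odd q) (hl : 0 < l)
    (ha : a 0 = l * (q + 1)) {η : K} (hη : IsPrimitiveRoot η (l * (q + 1)))
    {ξ : (j : Fin m) → Fin (a j) → K} (hξ : ∀ s, ξ 0 s = η ^ (s : ℕ)) {ζ : K}
    (hζ : IsPrimitiveRoot ζ (q ^ 2 - 1)) (hq1 : 1 < q)
    {e e' : Box a} (he : 2 * (e 0 : ℕ) < q + 1) (he' : 2 * (e' 0 : ℕ) < q + 1) :
    ∑ α, evalMonomial ξ (twistVector q ζ a) e α *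
      evalMonomial ξ (twistVector q ζ a) e' α ^ q = 0 := by
  have hζ' := pow_half_eq_neg_one hq hq1 hζ
  -- The values of `v ^ (q + 1)`: even blocks give `ζ ^ ((q ^ 2 - 1) / 2) = -1`, odd ones `1`. As `q
  -- + 1` is even, `u` closes up with period `l * (q + 1)`.
  let u : ℕ → K := fun s => -(-1) ^ (s / l)
  have hu : ∀ s, u (s + l) = -u s := fun s => by
    simp only [u, Nat.add_div_right _ hl, pow_succ]
    ring
  have huN : Function.Periodic u (l * (q + 1)) := fun s => by
    simp only [u]
    rw [Nat.add_mul_div_left _ _ hl, pow_add, hq.add_one.neg_one_pow, mul_one]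
  have htw : ∀ α : Box a, twistVector q ζ a α * twistVector q ζ a α ^ q = u (α 0) := by
    intro α
    rw [twistVector_apply ha, ← pow_succ']
    simp only [u]
    split_ifs with h
    · rw [h.neg_one_pow, ← pow_mul, hζ']
    · rw [(Nat.not_even_iff_odd.mp h).neg_one_pow, one_pow, neg_neg]
  have hterm : ∀ α : Box a, evalMonomial ξ (twistVector q ζ a) e α *
      evalMonomial ξ (twistVector q ζ a) e' α ^ q =
      u (α 0) * ∏ j, ξ j (α j) ^ ((e j : ℕ) + q * e' j) := by
    intro α
    simp only [evalMonomial, pow_add, Finset.prod_mul_distrib, mul_comm q, pow_mul,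
      Finset.prod_pow]
    rw [← htw α]
    ring
  simp only [hterm]
  rw [sum_apply_zero_mul_prod (fun s => u s) fun j s => ξ j s ^ ((e j : ℕ) + q * e' j)]
  have hzero := sum_range_antiperiodic_mul_pow (x := η ^ ((e 0 : ℕ) + q * e' 0)) hu huN
    (by rw [← pow_mul, mul_comm, pow_mul, hη.pow_eq_one, one_pow])
    (by
      rw [← pow_mul, mul_comm, pow_mul]
      exact pow_add_mul_ne_neg_one h2 (hη.pow (by positivity) rfl) he he')
  rw [← ha, ← Fin.sum_univ_eq_sum_range] at hzero
  simp only [hξ, ← pow_mul, mul_comm] at hzero ⊢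
  rw [hzero, mul_zero]

end SelfOrthogonality

theorem two_mul_apply_lt_of_mem_hyperbolicSet {m : ℕ} {a : Fin m → ℕ} {q t : ℕ}
    (ht : t ≤ (q + 3) / 2) {e : Box a} (he : e ∈ hyperbolicSet a t) (j : Fin m) :
    2 * (e j : ℕ) < q + 1 := by
  have h1 : (e j : ℕ) + 1 ≤ ∏ j, ((e j : ℕ) + 1) :=
    Finset.single_le_prod' (f := fun j => (e j : ℕ) + 1) (fun _ _ => Nat.le_add_left _ _)
      (Finset.mem_univ j)
  have h2 := (Finset.mem_filter.mp he).2
  omega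

end GMCC

/-! ### Assembly. -/

theorem theorem3p7 (q : ℕ) (hq : IsPrimePow q) (hodd : Odd q)
    {F : Type*} [Field F] [Fintype F] (hF : Fintype.card F = q)
    {K : Type*} [Field K] [Fintype K] (hK : Fintype.card K = q ^ 2)
    (m : ℕ) [NeZero m] (l : ℕ) (hl : l ∣ q - 1)
    (a : Fin m → ℕ) (ha₁ : a 0 = l * (q + 1))
    (ha : ∀ j, j ≠ 0 → 2 ≤ a j ∧ a j ≤ q ^ 2 - 1)
    (η : K) (hη : IsPrimitiveRoot η (l * (q + 1)))
    (ξ : (j : Fin m) → Fin (a j) → K)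
    (hξ₁ : ∀ s : Fin (a 0), ξ 0 s = η ^ (s : ℕ))
    (hξ : ∀ j, j ≠ 0 → Function.Injective (ξ j) ∧ ∀ s, ξ j s ≠ 0)
    (ζ : K) (hζ : IsPrimitiveRoot ζ (q ^ 2 - 1))
    (t : ℕ) (ht : 2 ≤ t) (ht' : t ≤ (q + 3) / 2) :
    GMCC.code ξ (GMCC.twistVector q ζ a) (GMCC.hyperbolicSet a t) ≤
        GMCC.hermitianDual q
          (GMCC.code ξ (GMCC.twistVector q ζ a) (GMCC.hyperbolicSet a t)) ∧
      2 * (GMCC.hyperbolicSet a t).card ≤ (∏ j, a j) ∧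
      GMCC.ExistsStabilizerCode F (∏ j, a j)
        ((∏ j, a j) - 2 * (GMCC.hyperbolicSet a t).card) t := by
  classical
  have hq1 : 1 < q := hq.one_lt
  have hl0 : 0 < l := Nat.pos_of_dvd_of_pos hl (by omega)
  obtain ⟨f⟩ := GMCC.nonempty_ringHom_of_card_eq_sq F K (by rw [hK, hF])
  algebraize [f]
  have h2F : (2 : F) ≠ 0 := by
    refine Ring.two_ne_zero fun h => ?_
    have := FiniteField.even_card_of_char_two h
    rw [Nat.odd_iff] at hodd
    omega
  have h2 : (2 : K) ≠ 0 := by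
    rw [← map_ofNat f 2]
    exact (map_ne_zero f).mpr h2F
  have hζ0 : ζ ≠ 0 := hζ.ne_zero (by
    have : 1 < q ^ 2 := Nat.one_lt_pow two_ne_zero hq1
    omega)
  have hξinj : ∀ j, Function.Injective (ξ j) := by
    intro j
    rcases eq_or_ne j 0 with rfl | hj
    · intro s s' h
      rw [hξ₁, hξ₁] at h
      exact Fin.ext (hη.pow_inj (ha₁ ▸ s.isLt) (ha₁ ▸ s'.isLt) h)
    · exact (hξ j hj).1
  have hv : ∀ α, GMCC.twistVector q ζ a α ≠ 0 := by
    intro α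
    rw [GMCC.twistVector]
    split_ifs
    exacts [pow_ne_zero _ hζ0, one_ne_zero]
  have hself : GMCC.code ξ (GMCC.twistVector q ζ a) (GMCC.hyperbolicSet a t) ≤
      GMCC.hermitianDual q
        (GMCC.code ξ (GMCC.twistVector q ζ a) (GMCC.hyperbolicSet a t)) := by
    rw [GMCC.code, ← hF]
    refine GMCC.span_le_hermitianDual ?_
    rw [hF]
    rintro _ ⟨e, he, rfl⟩ _ ⟨e', he', rfl⟩
    exact GMCC.sum_evalMonomial_mul_pow_eq_zero h2 hodd hl0 ha₁ hη hξ₁ hζ hq1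
      (GMCC.two_mul_apply_lt_of_mem_hyperbolicSet ht' he 0)
      (GMCC.two_mul_apply_lt_of_mem_hyperbolicSet ht' he' 0)
  -- `δ = ζ ^ ((q + 1) / 2)` works since `δ ^ (q - 1) = ζ ^ ((q ^ 2 - 1) / 2) = -1`.
  have hδ : (ζ ^ ((q + 1) / 2)) ^ q = -ζ ^ ((q + 1) / 2) := by
    have h := GMCC.pow_half_eq_neg_one hodd hq1 hζ
    have hexp : (q + 1) / 2 * q = (q - 1) / 2 * (q + 1) + (q + 1) / 2 := by
      obtain ⟨k, rfl⟩ := hodd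
      rw [Nat.add_sub_cancel, Nat.mul_div_cancel_left _ two_pos,
        show (2 * k + 1 + 1) / 2 = k + 1 by omega]
      ring
    rw [← pow_mul, hexp, pow_add, h, neg_one_mul]
  have hcode := GMCC.existsStabilizerCode_of_le_hermitianDual (F := F) (d := t) (by rw [hK, hF])
    (hF.symm ▸ hδ) (pow_ne_zero _ hζ0) h2F
    (Fintype.equivFinOfCardEq (α := GMCC.Box a) (n := ∏ j, a j) (by simp))
    (hF.symm ▸ hself) (fun x hx hxt =>
      GMCC.eq_zero_of_mem_hermitianDual hξinj hv Fintype.card_ne_zero hx hxt)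
  rw [GMCC.finrank_code hξinj hv] at hcode
  exact ⟨hself, hcode⟩
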